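/- Let $\lambda(G)$ denote the spectral radius of the adjacency matrix of a finite simple graph $G$. Write $K_s$ and $\overline{K}_s$ for the complete and the edgeless graph of order $s$, $G\vee H$ for the join of $G$ and $H$ (their disjoint union together with all edges between $G$ and $H$), and $G+H$ for their disjoint union. Let $k\ge 1$ and $n\ge k^3/2+k+4$ be integers, and put $$L_k(n)=K_1\vee(K_{n-k-1}+K_k),\qquad M_k(n)=K_k\vee(K_{n-2k}+\overline{K}_k).$$ Let $G$ be a graph of order $n$ with minimum degree $\delta(G)\ge k$. If $\lambda(G)\ge n-k-1$, then $G$ has a Hamiltonian cycle, unless $G$ is isomorphic to $L_k(n)$ or to $M_k(n)$. -/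

import Mathlib

/-- The join `G ∨ H`: the disjoint union of `G` and `H` together with all edges between the
vertices of `G` and the vertices of `H`. -/
def graphJoin {V W : Type*} (G : SimpleGraph V) (H : SimpleGraph W) : SimpleGraph (V ⊕ W) :=
  SimpleGraph.sum G H ⊔ completeBipartiteGraph V W

/-- `L_k(n) = K_1 ∨ (K_{n-k-1} + K_k)`, a graph of order `n` whenever `n ≥ k + 2`. -/
def graphL (k n : ℕ) : SimpleGraph (Fin 1 ⊕ (Fin (n - k - 1) ⊕ Fin k)) :=
  graphJoin (⊤ : SimpleGraph (Fin 1))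
    (SimpleGraph.sum (⊤ : SimpleGraph (Fin (n - k - 1))) (⊤ : SimpleGraph (Fin k)))

/-- `M_k(n) = K_k ∨ (K_{n-2k} + (complement of K_k))`, a graph of order `n` whenever
`n ≥ 2k`. -/
def graphM (k n : ℕ) : SimpleGraph (Fin k ⊕ (Fin (n - 2 * k) ⊕ Fin k)) :=
  graphJoin (⊤ : SimpleGraph (Fin k))
    (SimpleGraph.sum (⊤ : SimpleGraph (Fin (n - 2 * k))) (⊥ : SimpleGraph (Fin k)))

/-- The spectral radius `λ(G)` of the adjacency matrix of a finite graph `G`, as a real number.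
The matrix is real symmetric, so all its eigenvalues are real and the spectrum may be taken
over `ℝ`; the spectrum is finite, so the extended nonnegative value of Mathlib's
`spectralRadius` is finite. -/
noncomputable def graphSpectralRadius {V : Type*} [Fintype V] [DecidableEq V]
    (G : SimpleGraph V) [DecidableRel G.Adj] : ℝ :=
  (spectralRadius ℝ (G.adjMatrix ℝ)).toReal

/-! Put D = n - k - 1. An eigenvector for an eigenvalue of modulus λ(G) gives, after taking absolute
values, a nonzero y ≥ 0 with D y ≤ A y. This inequality survives adding edges. By symmetry of A it
is refuted by any w ≥ 0 with A w < D w entrywise, so spectral estimates reduce to choosing test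
vectors.

Let G have no spanning cycle and let H ⊇ G be edge-maximal with that property. By Ore's rotation,
nonadjacent vertices of H have degree sum below n, and Chvátal's argument gives an index i with k ≤
i < n/2, a set of i vertices of degree at most i, and n - i vertices of degree at most n - 1 - i
(`exists_chvatal_index`). A three-level test vector rules out i > k
(`IsSubsolution.chvatal_index_le`).

For i = k let X be the set of k vertices of degree k. The bound D (D - k + 1) ≤ 2m - (n - 1) k
forces H to be a clique off X (`isClique_compl_of_sum_degree`). By Ore's property each vertex off X
sees all of X or none of it, so H is determined by the set T of those that see all of it and by the
graph on X, with 1 ≤ |T| ≤ k. A second test vector shows that losing a single edge brings λ below D,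
so G = H (`IsSubsolution.eq_of_le`). If 2 ≤ |T| < k there is a spanning cycle after all
(`IsJoinDecomposition.hasSpanningCycle`); |T| = 1 gives L_k(n) and |T| = k gives M_k(n). -/

/-! ### Subsolutions and test vectors for the adjacency matrix -/

/-- A nonnegative vector witnessing `λ(G) ≥ D`. -/
structure IsSubsolution {V : Type*} [Fintype V] (G : SimpleGraph V) [DecidableRel G.Adj]
    (D : ℝ) (y : V → ℝ) : Prop where
  nonneg : ∀ u, 0 ≤ y u
  exists_pos : ∃ u, 0 < y u
  le : ∀ u, D * y u ≤ ∑ v ∈ G.neighborFinset u, y v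

theorem sum_sum_neighborFinset_comm {V : Type*} [Fintype V] (G : SimpleGraph V)
    [DecidableRel G.Adj] (f g : V → ℝ) :
    ∑ u, (∑ v ∈ G.neighborFinset u, f v) * g u = ∑ u, f u * ∑ v ∈ G.neighborFinset u, g v := by
  simp_rw [Finset.sum_mul, Finset.mul_sum]
  rw [Finset.sum_comm']
  simp [G.adj_comm]

/-- Absolute values of an eigenvector suffice, whatever the sign of the eigenvalue, so
Perron–Frobenius is not needed. The bound `0 < D` excludes an empty spectrum, whose spectral radius
is 0. -/
theorem exists_isSubsolution_of_le_graphSpectralRadius {V : Type*} [Fintype V] [DecidableEq V]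
    (G : SimpleGraph V) [DecidableRel G.Adj] {D : ℝ} (hD : 0 < D)
    (h : D ≤ graphSpectralRadius G) : ∃ y : V → ℝ, IsSubsolution G D y := by
  classical
  let _ : NormedRing (Matrix V V ℝ) := Matrix.linftyOpNormedRing
  let _ : NormedAlgebra ℝ (Matrix V V ℝ) := Matrix.linftyOpNormedAlgebra
  have hne : (spectrum ℝ (G.adjMatrix ℝ)).Nonempty := by
    by_contra hcon
    rw [Set.not_nonempty_iff_eq_empty] at hcon
    have : graphSpectralRadius G = 0 := by
      simp [graphSpectralRadius, spectralRadius, hcon]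
    linarith
  obtain ⟨μ, hμ, hμ'⟩ := spectrum.exists_nnnorm_eq_spectralRadius_of_nonempty hne
  have hD' : D ≤ |μ| := by
    refine h.trans (le_of_eq ?_)
    unfold graphSpectralRadius
    rw [← hμ']
    simp
  rw [← Matrix.spectrum_toLin', ← Module.End.hasEigenvalue_iff_mem_spectrum] at hμ
  obtain ⟨x, hx⟩ := hμ.exists_hasEigenvector
  have hx1 := hx.apply_eq_smul
  refine ⟨fun u => |x u|, fun u => abs_nonneg _, ?_, fun u => ?_⟩
  · obtain ⟨u, hu⟩ := Function.ne_iff.mp hx.2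
    exact ⟨u, abs_pos.mpr hu⟩
  · have := congrFun hx1 u
    rw [Matrix.toLin'_apply, SimpleGraph.adjMatrix_mulVec_apply] at this
    calc D * |x u| ≤ |μ| * |x u| := by gcongr
      _ = |∑ v ∈ G.neighborFinset u, x v| := by rw [this]; simp [abs_mul]
      _ ≤ _ := Finset.abs_sum_le_sum_abs _ _

theorem IsSubsolution.mono {V : Type*} [Fintype V] {G H : SimpleGraph V} [DecidableRel G.Adj]
    [DecidableRel H.Adj] {D : ℝ} {y : V → ℝ} (h : IsSubsolution G D y) (hGH : G ≤ H) :
    IsSubsolution H D y :=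
  ⟨h.nonneg, h.exists_pos, fun u => (h.le u).trans <|
    Finset.sum_le_sum_of_subset_of_nonneg
      (fun v hv => by simp only [SimpleGraph.mem_neighborFinset] at hv ⊢; exact hGH hv)
      fun v _ _ => h.nonneg v⟩

/-- A nonnegative strict supersolution excludes subsolutions. -/
theorem IsSubsolution.false_of_supersolution {V : Type*} [Fintype V] {G : SimpleGraph V}
    [DecidableRel G.Adj] {D : ℝ} {y : V → ℝ} (h : IsSubsolution G D y) (w : V → ℝ)
    (hw : ∀ u, 0 ≤ w u) (hlt : ∀ u, ∑ v ∈ G.neighborFinset u, w v < D * w u) : False := by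
  -- D⟨y, w⟩ ≤ ⟨Ay, w⟩ = ⟨y, Aw⟩ < D⟨y, w⟩.
  have h1 := sum_sum_neighborFinset_comm G y w
  have h2 : ∑ u, y u * ∑ v ∈ G.neighborFinset u, w v < ∑ u, y u * (D * w u) := by
    obtain ⟨u, hu⟩ := h.exists_pos
    exact Finset.sum_lt_sum (fun i _ => mul_le_mul_of_nonneg_left (hlt i).le (h.nonneg i))
      ⟨u, Finset.mem_univ _, mul_lt_mul_of_pos_left (hlt u) hu⟩
  have h3 : ∑ u, y u * (D * w u) ≤ ∑ u, (∑ v ∈ G.neighborFinset u, y v) * w u :=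
    Finset.sum_le_sum fun i _ => by
      nlinarith [mul_le_mul_of_nonneg_right (h.le i) (hw i)]
  linarith

/-- Stated for `D ≥ 0` and minimum degree at least `k`: `D (D - k + 1) ≤ 2m - (n - 1) k`. -/
theorem IsSubsolution.mul_le_sum_degree {V : Type*} [Fintype V] {G : SimpleGraph V}
    [DecidableRel G.Adj] {D : ℝ} (hD : 0 ≤ D) {y : V → ℝ} (h : IsSubsolution G D y) {k : ℕ}
    (hk : ∀ v, k ≤ G.degree v) :
    D * (D - k + 1) ≤ ∑ v, (G.degree v : ℝ) - (Fintype.card V - 1) * k := by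
  classical
  -- This is (A - (k - 1) I) applied to the all-ones vector. Every entry of A w is at most C, since
  -- the terms d(v) - k are nonnegative and may be summed over all vertices; pairing with y gives
  -- the bound.
  set w : V → ℝ := fun u => G.degree u - k + 1 with hw
  have hw0 : ∀ u, 0 ≤ w u := fun u => by
    have : (k : ℝ) ≤ G.degree u := by exact_mod_cast hk u
    simp only [hw]; linarith
  set C := ∑ v, (G.degree v : ℝ) - (Fintype.card V - 1) * k with hC
  have hS : 0 < ∑ u, y u := by
    obtain ⟨u, hu⟩ := h.exists_pos
    exact Finset.sum_pos' (fun i _ => h.nonneg i) ⟨u, Finset.mem_univ _, hu⟩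
  have h1 := sum_sum_neighborFinset_comm G y w
  have h2 : ∀ u, ∑ v ∈ G.neighborFinset u, w v ≤ C := by
    intro u
    have hsub : insert u (G.neighborFinset u) ⊆ Finset.univ := Finset.subset_univ _
    have hnot : u ∉ G.neighborFinset u := by simp
    have e1 : ∑ v ∈ G.neighborFinset u, ((G.degree v : ℝ) - k) + (G.degree u - k)
        ≤ ∑ v, ((G.degree v : ℝ) - k) := by
      rw [add_comm, ← Finset.sum_insert (f := fun v => (G.degree v : ℝ) - k) hnot]
      exact Finset.sum_le_sum_of_subset_of_nonneg hsub fun v _ _ => by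
        have : (k : ℝ) ≤ G.degree v := by exact_mod_cast hk v
        linarith
    have e2 : ∑ v ∈ G.neighborFinset u, w v
        = ∑ v ∈ G.neighborFinset u, ((G.degree v : ℝ) - k) + G.degree u := by
      simp only [hw, Finset.sum_add_distrib]
      simp
    rw [Finset.sum_sub_distrib (f := fun v => (G.degree v : ℝ)) (s := Finset.univ)] at e1
    simp only [Finset.sum_const, Finset.card_univ, nsmul_eq_mul] at e1
    rw [e2, hC]; linarith
  have h3 : ∑ u, y u * ∑ v ∈ G.neighborFinset u, w v ≤ (∑ u, y u) * C := by
    rw [Finset.sum_mul]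
    exact Finset.sum_le_sum fun i _ => mul_le_mul_of_nonneg_left (h2 i) (h.nonneg i)
  have h4 : D * ∑ u, y u * w u ≤ ∑ u, (∑ v ∈ G.neighborFinset u, y v) * w u := by
    rw [Finset.mul_sum]
    exact Finset.sum_le_sum fun i _ => by
      nlinarith [mul_le_mul_of_nonneg_right (h.le i) (hw0 i)]
  have h5 : (D - k + 1) * ∑ u, y u ≤ ∑ u, y u * w u := by
    have e := sum_sum_neighborFinset_comm G y (fun _ => 1)
    simp only [mul_one, Finset.sum_const, SimpleGraph.card_neighborFinset_eq_degree,
      nsmul_eq_mul] at e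
    have e' : D * ∑ u, y u ≤ ∑ u, ∑ v ∈ G.neighborFinset u, y v := by
      rw [Finset.mul_sum]; exact Finset.sum_le_sum fun i _ => h.le i
    have e'' : ∑ u, y u * w u = ∑ u, y u * (G.degree u : ℝ) - (k - 1) * ∑ u, y u := by
      rw [Finset.mul_sum, ← Finset.sum_sub_distrib]
      exact Finset.sum_congr rfl fun i _ => by simp only [hw]; ring
    rw [e'']; linarith
  have h6 : D * (D - k + 1) * ∑ u, y u ≤ C * ∑ u, y u := by
    nlinarith [mul_le_mul_of_nonneg_left h5 hD]
  exact le_of_mul_le_mul_right h6 hS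

/-! ### Spanning cycles and Ore's theorem -/

/-- `G` has a spanning cycle, given as a list of vertices read cyclically. -/
def HasSpanningCycle {V : Type*} (G : SimpleGraph V) : Prop :=
  ∃ l : List V, l.Nodup ∧ (∀ v, v ∈ l) ∧ Cycle.Chain G.Adj (l : Cycle V)

theorem cycle_chain_iff {α : Type*} (r : α → α → Prop) (l : List α) :
    Cycle.Chain r (l : Cycle α) ↔
      l.IsChain r ∧ ∀ x ∈ l.getLast?, ∀ y ∈ l.head?, r x y := by
  cases l with
  | nil => simp
  | cons a l =>
    rw [Cycle.chain_coe_cons, ← List.cons_append, List.isChain_append]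
    simp

/-- Order at least 3 is needed: a list of two adjacent vertices is also a closed chain, running
along one edge back and forth. -/
theorem HasSpanningCycle.exists_isHamiltonianCycle {V : Type*} [Fintype V] [DecidableEq V]
    {G : SimpleGraph V} (h : HasSpanningCycle G) (h3 : 3 ≤ Fintype.card V) :
    ∃ (v : V) (c : G.Walk v v), c.IsHamiltonianCycle := by
  obtain ⟨l, hnd, hall, hc⟩ := h
  have hlen : l.length = Fintype.card V := by
    rw [← List.toFinset_card_of_nodup hnd, ← Finset.card_univ]
    congr 1
    ext v; simp [hall]
  match l, hlen with
  | [], h => simp at h; omega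
  | [_], h => simp at h; omega
  | [_, _], h => simp at h; omega
  | a :: b :: c :: l, _ =>
    rw [Cycle.chain_coe_cons] at hc
    have hab : G.Adj a b := by simp at hc; tauto
    have hc' : ((b :: c :: l) ++ [a]).IsChain G.Adj := hc.tail
    have key : ∀ (m : List V) (hm : m ≠ []) (hch : m.IsChain G.Adj)
        (hb : m.head hm = b) (ha : m.getLast hm = a) (hm' : m = (b :: c :: l) ++ [a]),
        ∃ p : G.Walk b a, p.support = (b :: c :: l) ++ [a] := by
      intro m hm hch hb ha hm'
      subst hb ha
      exact ⟨SimpleGraph.Walk.ofSupport m hm hch, (SimpleGraph.Walk.support_ofSupport hm hch).trans hm'⟩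
    obtain ⟨p, hp⟩ := key ((b :: c :: l) ++ [a]) (by simp) hc' (by simp) (by simp) rfl
    have hpp : p.IsPath := by
      rw [SimpleGraph.Walk.isPath_def, hp]
      have : (b :: c :: l ++ [a]).Perm (a :: b :: c :: l) := by
        exact List.perm_append_singleton _ _
      exact this.nodup_iff.mpr hnd
    have hsupp : ∀ v, v ∈ p.support := by
      intro v
      have := hall v
      rw [hp]
      simp only [List.mem_cons, List.mem_append, List.not_mem_nil, or_false] at this ⊢
      tauto
    have hham := hpp.isHamiltonian_of_mem hsupp
    refine ⟨a, SimpleGraph.Walk.cons hab p, ?_, ?_⟩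
    · rw [SimpleGraph.Walk.cons_isCycle_iff]
      refine ⟨hpp, fun hmem => ?_⟩
      cases p with
      | nil => exact hab.ne rfl
      | @cons _ v _ h q =>
        rw [SimpleGraph.Walk.support_cons] at hp
        simp only [List.cons_append, List.cons.injEq, true_and] at hp
        rw [SimpleGraph.Walk.edges_cons, List.mem_cons] at hmem
        rw [SimpleGraph.Walk.cons_isPath_iff] at hpp
        -- If the closing edge were the first edge of the path, the path would end after one step
        -- and miss `c`; if it came later, the path would revisit `b`.
        rcases hmem with he | he
        · have hv : v = a := by
            have := hab.ne
            aesop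
          subst hv
          have := (SimpleGraph.Walk.isPath_iff_nil.mp hpp.1).eq_nil
          subst this
          have := congrArg List.length hp
          simp at this
        · exact hpp.2 (SimpleGraph.Walk.snd_mem_support_of_mem_edges _ he)
    · intro v
      simpa using hham v

/-- Ore's rotation: a spanning path with ends `u`, `v` and `d(u) + d(v) ≥ n` closes up. -/
theorem hasSpanningCycle_of_path {V : Type*} [Fintype V] {H : SimpleGraph V}
    [DecidableRel H.Adj] {u v : V} {l : List V} (hnd : l.Nodup) (hall : ∀ w, w ∈ l)
    (hch : l.IsChain H.Adj) (hu : l.head? = some u) (hv : l.getLast? = some v)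
    (hdeg : Fintype.card V ≤ H.degree u + H.degree v) : HasSpanningCycle H := by
  classical
  have hlen : l.length = Fintype.card V := by
    rw [← List.toFinset_card_of_nodup hnd, ← Finset.card_univ]
    congr 1
    ext v; simp [hall]
  have hpos : 0 < l.length := by
    cases l with
    | nil => simp at hu
    | cons => simp
  have hl0 : l[0] = u := by
    rw [List.head?_eq_getElem?, List.getElem?_eq_getElem hpos] at hu
    simpa using hu
  have hln : l[l.length - 1] = v := by
    rw [List.getLast?_eq_getElem?, List.getElem?_eq_getElem (by omega)] at hv
    simpa using hv
  -- Both sets lie among n - 1 positions and their sizes sum to at least n, so some i has u adjacent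
  -- to l[i+1] and v adjacent to l[i]. The default values of `getD` are never reached in this range.
  set A := (Finset.range (l.length - 1)).filter fun i => H.Adj u (l.getD (i + 1) u) with hA
  set B := (Finset.range (l.length - 1)).filter fun i => H.Adj v (l.getD i v) with hB
  have hAc : H.degree u ≤ A.card := by
    refine le_trans ?_ (Finset.card_image_le (s := A) (f := fun i => l.getD (i + 1) u))
    rw [← SimpleGraph.card_neighborFinset_eq_degree]
    refine Finset.card_le_card fun w hw => ?_
    rw [SimpleGraph.mem_neighborFinset] at hw
    obtain ⟨j, hj, rfl⟩ := List.getElem_of_mem (hall w)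
    have hj0 : j ≠ 0 := by
      rintro rfl
      exact hw.ne hl0.symm
    obtain ⟨i, rfl⟩ := Nat.exists_eq_succ_of_ne_zero hj0
    refine Finset.mem_image.mpr ⟨i, ?_, ?_⟩
    · simp only [hA, Finset.mem_filter, Finset.mem_range]
      refine ⟨by omega, ?_⟩
      rwa [List.getD_eq_getElem _ _ hj]
    · exact List.getD_eq_getElem _ _ hj
  have hBc : H.degree v ≤ B.card := by
    refine le_trans ?_ (Finset.card_image_le (s := B) (f := fun i => l.getD i v))
    rw [← SimpleGraph.card_neighborFinset_eq_degree]
    refine Finset.card_le_card fun w hw => ?_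
    rw [SimpleGraph.mem_neighborFinset] at hw
    obtain ⟨j, hj, rfl⟩ := List.getElem_of_mem (hall w)
    have hj0 : j ≠ l.length - 1 := by
      rintro rfl
      exact hw.ne hln.symm
    refine Finset.mem_image.mpr ⟨j, ?_, ?_⟩
    · simp only [hB, Finset.mem_filter, Finset.mem_range]
      refine ⟨by omega, ?_⟩
      rwa [List.getD_eq_getElem _ _ hj]
    · exact List.getD_eq_getElem _ _ hj
  have hne : (A ∩ B).Nonempty := by
    by_contra hcon
    rw [Finset.not_nonempty_iff_eq_empty, ← Finset.disjoint_iff_inter_eq_empty] at hcon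
    have h1 := Finset.card_union_of_disjoint hcon
    have h2 : (A ∪ B).card ≤ (Finset.range (l.length - 1)).card :=
      Finset.card_le_card (Finset.union_subset (Finset.filter_subset _ _)
        (Finset.filter_subset _ _))
    rw [Finset.card_range] at h2
    omega
  obtain ⟨i, hi⟩ := hne
  simp only [hA, hB, Finset.mem_inter, Finset.mem_filter, Finset.mem_range] at hi
  obtain ⟨⟨hi, hui⟩, -, hvi⟩ := hi
  rw [List.getD_eq_getElem _ _ (by omega)] at hui hvi
  have hperm : (l.take (i + 1) ++ (l.drop (i + 1)).reverse).Perm l := by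
    conv_rhs => rw [← List.take_append_drop (i + 1) l]
    exact (List.reverse_perm _).append_left _
  -- Follow the path from u to l[i], jump to v, return to l[i+1], and close up at u.
  refine ⟨l.take (i + 1) ++ (l.drop (i + 1)).reverse, hperm.nodup_iff.mpr hnd,
    fun w => hperm.mem_iff.mpr (hall w), ?_⟩
  have hdne : l.drop (i + 1) ≠ [] := by
    intro h
    rw [List.drop_eq_nil_iff] at h
    omega
  rw [cycle_chain_iff, List.isChain_append, List.isChain_reverse]
  refine ⟨⟨hch.take _, ?_, ?_⟩, ?_⟩
  · exact (hch.drop _).imp fun _ _ h => h.symm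
  · intro x hx y hy
    rw [List.head?_reverse, List.getLast?_drop, if_neg (by omega), hv] at hy
    rw [List.getLast?_take, if_neg (by omega)] at hx
    simp only [Nat.add_sub_cancel, List.getElem?_eq_getElem (show i < l.length by omega)] at hx
    simp only [Option.some_or, Option.mem_def, Option.some.injEq] at hx hy
    subst hx hy
    exact hvi.symm
  · intro x hx y hy
    rw [List.getLast?_append, List.getLast?_reverse, List.head?_drop,
      List.getElem?_eq_getElem (show i + 1 < l.length by omega)] at hx
    rw [List.head?_append, List.head?_take, if_neg (by omega), hu] at hy
    simp only [Option.some_or, Option.mem_def, Option.some.injEq] at hx hy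
    subst hx hy
    exact hui.symm

/-- The two ends of a path on at least three vertices are not consecutive on it, so the edge joining
them is not used. -/
theorem isChain_of_head_getLast {V : Type*} {H : SimpleGraph V} {u v : V} {l : List V}
    (hnd : l.Nodup) (h3 : 3 ≤ l.length) (hch : l.IsChain (H ⊔ SimpleGraph.edge u v).Adj)
    (hu : l.head? = some u) (hv : l.getLast? = some v) : l.IsChain H.Adj := by
  have hl0 : l[0] = u := by
    rw [List.head?_eq_getElem?, List.getElem?_eq_getElem (by omega)] at hu
    simpa using hu
  have hln : l[l.length - 1] = v := by
    rw [List.getLast?_eq_getElem?, List.getElem?_eq_getElem (by omega)] at hv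
    simpa using hv
  rw [List.isChain_iff_getElem] at hch ⊢
  intro i hi
  have := hch i hi
  rw [SimpleGraph.sup_adj, SimpleGraph.edge_adj] at this
  rcases this with h | ⟨⟨h1, h2⟩ | ⟨h1, h2⟩, -⟩
  · exact h
  · have e1 := (hnd.getElem_inj_iff).mp (h1.trans hl0.symm)
    have e2 := (hnd.getElem_inj_iff).mp (h2.trans hln.symm)
    omega
  · have e2 := (hnd.getElem_inj_iff).mp (h2.trans hl0.symm)
    omega

/-- Adding an edge between vertices of large degree sum does not create spanning cycles. -/
theorem hasSpanningCycle_of_sup_edge {V : Type*} [Fintype V] {H : SimpleGraph V}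
    [DecidableRel H.Adj] (h3 : 3 ≤ Fintype.card V) {u v : V}
    (hdeg : Fintype.card V ≤ H.degree u + H.degree v)
    (h : HasSpanningCycle (H ⊔ SimpleGraph.edge u v)) : HasSpanningCycle H := by
  classical
  -- If the cycle uses the added edge, rotate it so that this edge closes the list; what remains is
  -- a spanning path of `H` with ends u and v.
  have aux : ∀ l : List V, l.Nodup → (∀ w, w ∈ l) →
      l.IsChain (H ⊔ SimpleGraph.edge u v).Adj →
      (∀ x ∈ l.getLast?, ∀ y ∈ l.head?, x = u ∧ y = v ∨ x = v ∧ y = u) →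
      HasSpanningCycle H := by
    intro l hnd hall hch hends
    have hlen : l.length = Fintype.card V := by
      rw [← List.toFinset_card_of_nodup hnd, ← Finset.card_univ]
      congr 1
      ext v; simp [hall]
    obtain ⟨x, hx⟩ : ∃ x, l.getLast? = some x := by
      cases hh : l.getLast? with
      | none => simp at hh; subst hh; simp at hlen; omega
      | some x => exact ⟨x, rfl⟩
    obtain ⟨y, hy⟩ : ∃ y, l.head? = some y := by
      cases hh : l.head? with
      | none => simp at hh; subst hh; simp at hlen; omega
      | some x => exact ⟨x, rfl⟩
    rcases hends x hx y hy with ⟨rfl, rfl⟩ | ⟨rfl, rfl⟩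
    · rw [SimpleGraph.edge_comm] at hch
      exact hasSpanningCycle_of_path hnd hall
        (isChain_of_head_getLast hnd (by omega) hch hy hx) hy hx (by omega)
    · exact hasSpanningCycle_of_path hnd hall
        (isChain_of_head_getLast hnd (by omega) hch hy hx) hy hx (by omega)
  have hadj : ∀ x y, (H ⊔ SimpleGraph.edge u v).Adj x y → ¬ H.Adj x y →
      x = u ∧ y = v ∨ x = v ∧ y = u := by
    intro x y h1 h2
    rw [SimpleGraph.sup_adj, SimpleGraph.edge_adj] at h1
    tauto
  obtain ⟨l, hnd, hall, hc⟩ := h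
  rw [cycle_chain_iff] at hc
  by_cases hH : l.IsChain H.Adj
  · by_cases hcl : ∀ x ∈ l.getLast?, ∀ y ∈ l.head?, H.Adj x y
    · exact ⟨l, hnd, hall, (cycle_chain_iff _ _).mpr ⟨hH, hcl⟩⟩
    · push Not at hcl
      obtain ⟨x, hx, y, hy, hxy⟩ := hcl
      refine aux l hnd hall hc.1 fun x' hx' y' hy' => ?_
      obtain rfl := Option.mem_unique hx hx'
      obtain rfl := Option.mem_unique hy hy'
      exact hadj _ _ (hc.2 x hx y hy) hxy
  · rw [List.isChain_iff_getElem] at hH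
    push Not at hH
    obtain ⟨i, hi, hni⟩ := hH
    have hi' := List.isChain_iff_getElem.mp hc.1 i hi
    have hperm : (l.drop (i + 1) ++ l.take (i + 1)).Perm l := by
      conv_rhs => rw [← List.take_append_drop (i + 1) l]
      exact List.perm_append_comm
    have hdne : l.drop (i + 1) ≠ [] := by
      intro h
      rw [List.drop_eq_nil_iff] at h
      omega
    refine aux _ (hperm.nodup_iff.mpr hnd) (fun w => hperm.mem_iff.mpr (hall w)) ?_ ?_
    · rw [List.isChain_append]
      refine ⟨hc.1.drop _, hc.1.take _, fun x hx y hy => hc.2 x ?_ y ?_⟩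
      · rwa [List.getLast?_drop, if_neg (by omega)] at hx
      · rwa [List.head?_take, if_neg (by omega)] at hy
    · intro x hx y hy
      rw [List.head?_append, List.head?_drop,
        List.getElem?_eq_getElem (show i + 1 < l.length by omega)] at hy
      rw [List.getLast?_append, List.getLast?_take, if_neg (by omega)] at hx
      simp only [Nat.add_sub_cancel, List.getElem?_eq_getElem (show i < l.length by omega)] at hx
      simp only [Option.some_or, Option.mem_def, Option.some.injEq] at hx hy
      subst hx hy
      exact hadj _ _ hi' hni

theorem HasSpanningCycle.mono {V : Type*} {G H : SimpleGraph V} (hGH : G ≤ H)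
    (h : HasSpanningCycle G) : HasSpanningCycle H := by
  obtain ⟨l, h1, h2, h3⟩ := h
  exact ⟨l, h1, h2, h3.imp fun _ _ h => hGH h⟩

theorem hasSpanningCycle_top (V : Type*) [Fintype V] (h2 : 2 ≤ Fintype.card V) :
    HasSpanningCycle (⊤ : SimpleGraph V) := by
  have hnd := Finset.nodup_toList (Finset.univ : Finset V)
  refine ⟨Finset.univ.toList, hnd, by simp, ?_⟩
  rw [cycle_chain_iff]
  refine ⟨List.Pairwise.isChain (hnd.imp fun h => h), ?_⟩
  have hlen : (Finset.univ : Finset V).toList.length = Fintype.card V := by simp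
  intro x hx y hy hxy
  subst hxy
  rw [List.getLast?_eq_getElem?, List.getElem?_eq_getElem (by omega)] at hx
  rw [List.head?_eq_getElem?, List.getElem?_eq_getElem (by omega)] at hy
  simp only [Option.mem_def, Option.some.injEq] at hx hy
  have := (hnd.getElem_inj_iff).mp (hx.trans hy.symm)
  omega

/-- A graph without spanning cycle extends to an edge-maximal one, in which nonadjacent vertices
have degree sum less than the order. -/
theorem exists_le_ore_of_not_hasSpanningCycle {V : Type*} [Fintype V] {G : SimpleGraph V}
    (h3 : 3 ≤ Fintype.card V) (hG : ¬ HasSpanningCycle G) :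
    ∃ H : SimpleGraph V, G ≤ H ∧ ¬ HasSpanningCycle H ∧ ∀ [DecidableRel H.Adj],
      ∀ u v, u ≠ v → ¬ H.Adj u v → H.degree u + H.degree v < Fintype.card V := by
  classical
  obtain ⟨H, hGH, hH⟩ :=
    (Set.toFinite {H : SimpleGraph V | ¬ HasSpanningCycle H}).exists_le_maximal hG
  refine ⟨H, hGH, hH.1, ?_⟩
  intro _ u v huv hadj
  by_contra hcon
  push Not at hcon
  have hmem : ¬ HasSpanningCycle (H ⊔ SimpleGraph.edge u v) := fun h =>
    hH.1 (hasSpanningCycle_of_sup_edge h3 hcon h)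
  have hle := hH.2 hmem le_sup_left
  exact hadj (hle (by rw [SimpleGraph.sup_adj, SimpleGraph.edge_adj]; tauto))

/-- Ore's theorem. -/
theorem hasSpanningCycle_of_ore {V : Type*} [Fintype V] {G : SimpleGraph V}
    [DecidableRel G.Adj] (h3 : 3 ≤ Fintype.card V)
    (h : ∀ u v, u ≠ v → ¬ G.Adj u v → Fintype.card V ≤ G.degree u + G.degree v) :
    HasSpanningCycle G := by
  classical
  by_contra hG
  obtain ⟨H, hGH, hH, hore⟩ := exists_le_ore_of_not_hasSpanningCycle h3 hG
  refine hH ((hasSpanningCycle_top V (by omega)).mono fun u v huv => ?_)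
  by_contra hadj
  have h1 := hore u v huv hadj
  have h2 := h u v huv fun h => hadj (hGH h)
  have h3 := SimpleGraph.degree_le_of_le hGH (v := u)
  have h4 := SimpleGraph.degree_le_of_le hGH (v := v)
  omega

/-! ### Chvátal's degree condition -/

/-- Chvátal's degree condition for a nonhamiltonian graph with Ore's property. -/
theorem exists_chvatal_index {V : Type*} [Fintype V] {H : SimpleGraph V}
    [DecidableRel H.Adj] (h3 : 3 ≤ Fintype.card V) (hH : ¬ HasSpanningCycle H)
    (hore : ∀ u v, u ≠ v → ¬ H.Adj u v → H.degree u + H.degree v < Fintype.card V)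
    {k : ℕ} (hk : ∀ v, k ≤ H.degree v) :
    ∃ (i : ℕ) (L B : Finset V), k ≤ i ∧ 2 * i < Fintype.card V ∧ L ⊆ B ∧ L.card = i ∧
      B.card = Fintype.card V - i ∧ (∀ v ∈ L, H.degree v ≤ i) ∧
      ∀ v ∈ B, H.degree v ≤ Fintype.card V - 1 - i := by
  classical
  have hex : (Finset.univ.filter fun p : V × V => p.1 ≠ p.2 ∧ ¬ H.Adj p.1 p.2).Nonempty := by
    by_contra hcon
    rw [Finset.not_nonempty_iff_eq_empty, Finset.filter_eq_empty_iff] at hcon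
    refine hH ((hasSpanningCycle_top V (by omega)).mono fun u v huv => ?_)
    have := hcon (Finset.mem_univ (u, v))
    by_contra h
    exact this ⟨huv, h⟩
  -- Choose a nonadjacent pair of maximal degree sum with d(u) ≤ d(v), and take i = d(u). By
  -- maximality the nonneighbours of v, at least i in number, have degree at most d(u). Likewise u
  -- and its nonneighbours, n - i vertices in all, have degree at most d(v) ≤ n - 1 - i.
  obtain ⟨⟨u, v⟩, hp, hmax⟩ := Finset.exists_max_image _
    (fun p : V × V => H.degree p.1 + H.degree p.2) hex
  wlog hle : H.degree u ≤ H.degree v generalizing u v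
  · refine this v u ?_ ?_ (by omega)
    · simp only [Finset.mem_filter, Finset.mem_univ, true_and] at hp ⊢
      exact ⟨hp.1.symm, fun h => hp.2 h.symm⟩
    · intro q hq
      have := hmax q hq
      simp only at this ⊢
      omega
  simp only [Finset.mem_filter, Finset.mem_univ, true_and] at hp
  have hmax' : ∀ a b, a ≠ b → ¬ H.Adj a b →
      H.degree a + H.degree b ≤ H.degree u + H.degree v := fun a b hab hadj =>
    hmax (a, b) (by simp [hab, hadj])
  have hsum := hore u v hp.1 hp.2
  have hcompl : ∀ w, ((insert w (H.neighborFinset w))ᶜ).card =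
      Fintype.card V - (H.degree w + 1) := by
    intro w
    rw [Finset.card_compl, Finset.card_insert_of_notMem (by simp),
      SimpleGraph.card_neighborFinset_eq_degree]
  have hmemc : ∀ w x, x ∈ (insert w (H.neighborFinset w))ᶜ ↔ x ≠ w ∧ ¬ H.Adj w x := by
    intro w x
    simp
  obtain ⟨L, hL, hLc⟩ := Finset.exists_subset_card_eq
    (s := (insert v (H.neighborFinset v))ᶜ) (n := H.degree u) (by rw [hcompl]; omega)
  have hLdeg : ∀ w ∈ L, H.degree w ≤ H.degree u := by
    intro w hw
    have := (hmemc v w).mp (hL hw)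
    have := hmax' w v this.1 fun h => this.2 h.symm
    omega
  set B₀ := Finset.univ.filter fun w => H.degree w ≤ Fintype.card V - 1 - H.degree u with hB₀
  have hLB : L ⊆ B₀ := fun w hw => by
    have := hLdeg w hw
    simp only [hB₀, Finset.mem_filter, Finset.mem_univ, true_and]
    omega
  have hB₀c : Fintype.card V - H.degree u ≤ B₀.card := by
    have hsub : insert u (insert u (H.neighborFinset u))ᶜ ⊆ B₀ := by
      intro w hw
      simp only [hB₀, Finset.mem_filter, Finset.mem_univ, true_and]
      rcases Finset.mem_insert.mp hw with rfl | hw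
      · omega
      · have := (hmemc u w).mp hw
        have := hmax' u w this.1.symm this.2
        omega
    have := Finset.card_le_card hsub
    rw [Finset.card_insert_of_notMem (by simp), hcompl] at this
    omega
  obtain ⟨B, hLB', hBB, hBc⟩ := Finset.exists_subsuperset_card_eq hLB
    (n := Fintype.card V - H.degree u) (by omega) hB₀c
  refine ⟨H.degree u, L, B, hk u, by omega, hLB', hLc, hBc, hLdeg, fun w hw => ?_⟩
  have := hBB hw
  simpa only [hB₀, Finset.mem_filter, Finset.mem_univ, true_and] using this

/-! ### Excluding Chvátal indices above k -/

/-- With i = k + j this is the top-row condition of the test vector in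
`IsSubsolution.chvatal_index_le`. Since k + 2j ≤ D, it usually suffices that (k + j)² < j (D + 1).
For k = 2 and j = 1 this fails when D ≤ 8, so small j are treated directly. The last two hypotheses
record what integrality of D and j provides. -/
theorem chvatal_index_inequality {k j D : ℝ} (hk : k = 1 ∨ k = 2 ∨ 3 ≤ k) (hj : 1 ≤ j)
    (hD : k ^ 3 / 2 + 3 ≤ D) (hjD : k + 2 * j ≤ D)
    (hD1 : k = 1 → 4 ≤ D) (h2 : k = 2 → D < 8 → j ≤ 2) :
    (k + j) ^ 2 * (k + 2 * j) < j * (D + 1) * D := by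
  have hD0 : 0 < D := by rcases hk with h | h | h <;> linarith
  have key : (k + j) ^ 2 < j * (D + 1) → (k + j) ^ 2 * (k + 2 * j) < j * (D + 1) * D := by
    intro h
    calc (k + j) ^ 2 * (k + 2 * j) ≤ (k + j) ^ 2 * D := by gcongr
      _ < j * (D + 1) * D := by gcongr
  rcases hk with rfl | rfl | hk
  · apply key
    have := hD1 rfl
    rcases le_total j 2 with h | h <;> nlinarith
  · rcases lt_or_ge D 8 with h | h
    · have hj2 := h2 rfl h
      have hDD : 56 ≤ (D + 1) * D := by nlinarith
      calc (2 + j) ^ 2 * (2 + 2 * j) < j * 56 := by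
            nlinarith [mul_nonneg (mul_nonneg (sub_nonneg.mpr hj) (sub_nonneg.mpr hj2))
              (by linarith : (0 : ℝ) ≤ j + 8)]
        _ ≤ j * ((D + 1) * D) := by gcongr
        _ = _ := by ring
    · rcases le_total j 3 with h3 | h3
      · have hDD : 72 ≤ (D + 1) * D := by nlinarith
        calc (2 + j) ^ 2 * (2 + 2 * j) < j * 72 := by
              nlinarith [mul_nonneg (mul_nonneg (sub_nonneg.mpr hj) (sub_nonneg.mpr h3))
                (by linarith : (0 : ℝ) ≤ j + 9)]
          _ ≤ j * ((D + 1) * D) := by gcongr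
          _ = _ := by ring
      · apply key
        nlinarith
  · apply key
    rcases le_total j (2 * k) with h | h
    · have e : k ^ 2 + 2 * k + 1 ≤ D := by
        nlinarith [mul_nonneg (sq_nonneg k) (sub_nonneg.mpr hk), sq_nonneg (k - 2)]
      have e2 : 0 ≤ (j - 1) * (k ^ 2 - (j - 1)) :=
        mul_nonneg (by linarith) (by nlinarith [sq_nonneg (k - 1)])
      nlinarith
    · nlinarith

/-- The Chvátal index of a graph with large spectral radius cannot exceed `k`. -/
theorem IsSubsolution.chvatal_index_le {V : Type*} [Fintype V] {H : SimpleGraph V}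
    [DecidableRel H.Adj] {k i : ℕ} {D : ℝ} {y : V → ℝ} (h : IsSubsolution H D y)
    (hV : (Fintype.card V : ℝ) = D + k + 1) (hi : 2 * i < Fintype.card V) (hki : k < i)
    {L B : Finset V} (hLB : L ⊆ B) (hL : L.card = i) (hB : B.card = Fintype.card V - i)
    (hLdeg : ∀ v ∈ L, H.degree v ≤ i) (hBdeg : ∀ v ∈ B, H.degree v ≤ Fintype.card V - 1 - i)
    (hineq : (i : ℝ) ^ 2 * (2 * i - k) < (i - k) * (D + 1) * D) : False := by
  classical
  have hi' : 2 * (i : ℝ) ≤ D + k := by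
    have : ((2 * i + 1 : ℕ) : ℝ) ≤ Fintype.card V := by exact_mod_cast hi
    push_cast at this
    linarith
  have hki' : (k : ℝ) + 1 ≤ i := by exact_mod_cast hki
  have hk0 : (0 : ℝ) ≤ k := Nat.cast_nonneg k
  have hD : 0 < D := by linarith
  have hE : 0 < 2 * (i : ℝ) - k := by linarith
  -- The weights are c on L, b on B \ L and 1 off B. The values b₀ and c₀ make the estimates for the
  -- rows of B \ L and L equalities; the row off B is then strict exactly by `hineq`.
  set b₀ : ℝ := i / (2 * i - k) with hb₀
  set c₀ : ℝ := i / D with hc₀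
  have hb₀1 : b₀ < 1 := by rw [hb₀, div_lt_one hE]; linarith
  have hcb : c₀ ≤ b₀ := div_le_div_of_nonneg_left (by linarith) hE (by linarith)
  have hb₀e : (2 * i - k) * b₀ = i := by rw [hb₀]; field_simp
  have hc₀e : D * c₀ = i := by rw [hc₀]; field_simp
  have hc₀0 : 0 ≤ c₀ := by positivity
  have htop : (i - 1 : ℝ) + (D + k + 1 - 2 * i) * b₀ + i * c₀ < D := by
    have e : (2 * i - k) * D * (D - ((i - 1 : ℝ) + (D + k + 1 - 2 * i) * b₀ + i * c₀))
        = (i - k) * (D + 1) * D - i ^ 2 * (2 * i - k) := by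
      linear_combination (-(D * (D + k + 1 - 2 * i))) * hb₀e - (i * (2 * i - k)) * hc₀e
    have : 0 < (2 * i - k) * D * (D - ((i - 1 : ℝ) + (D + k + 1 - 2 * i) * b₀ + i * c₀)) := by
      rw [e]; linarith
    have := (mul_pos_iff_of_pos_left (mul_pos hE hD)).mp this
    linarith
  -- Raising b₀ and c₀ by ε makes the two tight rows strict; the choice of ε spends at most half of
  -- the slack s of the top row.
  obtain ⟨ε, hε, hε1, hεtop⟩ : ∃ ε : ℝ, 0 < ε ∧ b₀ + ε ≤ 1 ∧
      (i - 1 : ℝ) + (D + k + 1 - 2 * i) * (b₀ + ε) + i * (c₀ + ε) < D := by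
    set s := D - ((i - 1 : ℝ) + (D + k + 1 - 2 * i) * b₀ + i * c₀) with hs
    have hs0 : 0 < s := by rw [hs]; linarith
    have hq : 0 < D + k + 1 - i := by linarith
    refine ⟨min (1 - b₀) (s / (2 * (D + k + 1 - i))), lt_min (by linarith) (by positivity),
      by linarith [min_le_left (1 - b₀) (s / (2 * (D + k + 1 - i)))], ?_⟩
    have h1 := min_le_right (1 - b₀) (s / (2 * (D + k + 1 - i)))
    set ε := min (1 - b₀) (s / (2 * (D + k + 1 - i)))
    have h2 : (D + k + 1 - i) * ε ≤ s / 2 := by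
      calc (D + k + 1 - i) * ε ≤ (D + k + 1 - i) * (s / (2 * (D + k + 1 - i))) := by gcongr
        _ = s / 2 := by field_simp
    nlinarith
  set b := b₀ + ε with hb
  set c := c₀ + ε with hc
  have hcb' : c ≤ b := by linarith
  have hc0 : 0 < c := by linarith
  have hmid : b * (D + k - i) + (1 - b) * i < D * b := by
    have : b * (D + k - i) + (1 - b) * i = D * b - (2 * i - k) * ε := by
      rw [hb]; linear_combination -hb₀e
    linarith [mul_pos hE hε]
  have hlow : (i : ℝ) < D * c := by
    have : D * c = i + D * ε := by rw [hc]; linear_combination hc₀e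
    linarith [mul_pos hD hε]
  set w : V → ℝ := fun v => if v ∈ L then c else if v ∈ B then b else 1 with hw
  have hw0 : ∀ v, 0 ≤ w v := fun v => by simp only [hw]; split_ifs <;> linarith
  have hw1 : ∀ v, w v ≤ 1 := fun v => by simp only [hw]; split_ifs <;> linarith
  have hwB : ∀ v ∈ B, w v ≤ b := fun v hv => by simp only [hw, hv, if_true]; split_ifs <;> linarith
  have hcV : i ≤ Fintype.card V := by omega
  have hBc : (Bᶜ.card : ℝ) = i := by
    have : Bᶜ.card = i := by rw [Finset.card_compl]; omega
    exact_mod_cast this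
  have hNi : ((Fintype.card V - 1 - i : ℕ) : ℝ) = D + k - i := by
    rw [Nat.sub_sub, Nat.cast_sub (by omega)]; push_cast; linarith
  refine h.false_of_supersolution w hw0 fun u => ?_
  by_cases huL : u ∈ L
  · have hwu : w u = c := by simp [hw, huL]
    rw [hwu]
    calc ∑ v ∈ H.neighborFinset u, w v ≤ ∑ v ∈ H.neighborFinset u, 1 :=
          Finset.sum_le_sum fun v _ => hw1 v
      _ = H.degree u := by simp
      _ ≤ i := by exact_mod_cast hLdeg u huL
      _ < D * c := hlow
  by_cases huB : u ∈ B
  · have hwu : w u = b := by simp [hw, huL, huB]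
    rw [hwu]
    refine lt_of_le_of_lt ?_ hmid
    have h1 : ∀ v, w v ≤ b + (1 - b) * (if v ∈ Bᶜ then 1 else 0) := by
      intro v
      by_cases hv : v ∈ B
      · simpa [hv] using hwB v hv
      · simpa [hv] using hw1 v
    calc ∑ v ∈ H.neighborFinset u, w v
        ≤ ∑ v ∈ H.neighborFinset u, (b + (1 - b) * (if v ∈ Bᶜ then 1 else 0)) :=
          Finset.sum_le_sum fun v _ => h1 v
      _ = b * H.degree u + (1 - b) * ∑ v ∈ H.neighborFinset u, (if v ∈ Bᶜ then 1 else 0) := by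
          rw [Finset.sum_add_distrib, Finset.mul_sum]; simp [mul_comm]
      _ ≤ b * (D + k - i) + (1 - b) * i := by
          have hd : (H.degree u : ℝ) ≤ D + k - i := by
            rw [← hNi]; exact_mod_cast hBdeg u huB
          have hs : ∑ v ∈ H.neighborFinset u, (if v ∈ Bᶜ then (1 : ℝ) else 0) ≤ i := by
            rw [← hBc, Finset.sum_ite_mem]
            simp only [Finset.sum_const, nsmul_eq_mul, mul_one]
            exact_mod_cast Finset.card_le_card Finset.inter_subset_right
          have hb0 : 0 ≤ b := by linarith
          have hb1 : 0 ≤ 1 - b := by linarith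
          gcongr
  · have hwu : w u = 1 := by simp [hw, huL, huB]
    rw [hwu, mul_one]
    have htot : ∑ v, w v = i + (D + k + 1 - 2 * i) * b + i * c := by
      have e : ∀ v, w v = (if v ∈ Bᶜ then 1 else 0) + (if v ∈ B \ L then b else 0)
          + (if v ∈ L then c else 0) := by
        intro v
        by_cases hv : v ∈ L
        · simp [hw, hv, hLB hv]
        · by_cases hv' : v ∈ B <;> simp [hw, hv, hv']
      have hBL : ((B \ L).card : ℝ) = D + k + 1 - 2 * i := by
        have : (B \ L).card + 2 * i = Fintype.card V := by
          rw [Finset.card_sdiff_of_subset hLB]; omega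
        have : ((B \ L).card : ℝ) + 2 * i = Fintype.card V := by exact_mod_cast this
        linarith
      rw [Finset.sum_congr rfl fun v _ => e v, Finset.sum_add_distrib, Finset.sum_add_distrib]
      simp only [Finset.sum_ite_mem, Finset.univ_inter, Finset.sum_const, nsmul_eq_mul, hBc, hBL, hL]
      ring
    have hle : ∑ v ∈ H.neighborFinset u, w v + w u ≤ ∑ v, w v := by
      rw [add_comm, ← Finset.sum_insert (by simp)]
      exact Finset.sum_le_sum_of_subset_of_nonneg (Finset.subset_univ _) fun v _ _ => hw0 v
    linarith

/-! ### Structure at index k -/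

/-- `H` is a clique off `X`, the vertices of `T` see all of `X`, the other vertices off `X` see
none of it, and the `k` vertices of `X` have degree `k`. -/
structure IsJoinDecomposition {V : Type*} [Fintype V] (H : SimpleGraph V) [DecidableRel H.Adj]
    (k : ℕ) (X T : Finset V) : Prop where
  card_eq : X.card = k
  notMem : ∀ v ∈ T, v ∉ X
  clique : ∀ p q, p ∉ X → q ∉ X → p ≠ q → H.Adj p q
  adj : ∀ t ∈ T, ∀ x ∈ X, H.Adj t x
  not_adj : ∀ c, c ∉ X → c ∉ T → ∀ x ∈ X, ¬ H.Adj c x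
  degree_eq : ∀ x ∈ X, H.degree x = k

/-- The degree caps are k on L, D on B \ L and D + k off B, with total D (D + 1) + 2k². By `hsum`
the degrees sum to at least D (D + 1) + k², so the total deficiency is at most k². A nonadjacent
pair off L has degree sum at most D + k, hence deficiency at least D - k > k². -/
theorem isClique_compl_of_sum_degree {V : Type*} [Fintype V] {H : SimpleGraph V}
    [DecidableRel H.Adj] {k : ℕ} {D : ℝ} (hV : (Fintype.card V : ℝ) = D + k + 1)
    (hkD : (k : ℝ) ^ 2 + k < D)
    (hsum : D * (D - k + 1) ≤ ∑ v, (H.degree v : ℝ) - (Fintype.card V - 1) * k)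
    (hore : ∀ u v, u ≠ v → ¬ H.Adj u v → H.degree u + H.degree v < Fintype.card V)
    {L B : Finset V} (hLB : L ⊆ B) (hL : L.card = k) (hB : B.card = Fintype.card V - k)
    (hLdeg : ∀ v ∈ L, H.degree v ≤ k) (hBdeg : ∀ v ∈ B, H.degree v ≤ Fintype.card V - 1 - k)
    {p q : V} (hp : p ∉ L) (hq : q ∉ L) (hpq : p ≠ q) : H.Adj p q := by
  classical
  by_contra hadj
  have hpqd : (H.degree p : ℝ) + H.degree q + 1 ≤ Fintype.card V := by
    exact_mod_cast hore p q hpq hadj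
  have hk0 : (0 : ℝ) ≤ k := Nat.cast_nonneg k
  have hD0 : 0 < D := by nlinarith
  have hkV : k + 1 ≤ Fintype.card V := by
    have : ((k + 1 : ℕ) : ℝ) ≤ Fintype.card V := by push_cast; linarith
    exact_mod_cast this
  have hDn : ((Fintype.card V - 1 - k : ℕ) : ℝ) = D := by
    rw [Nat.sub_sub, Nat.cast_sub (by omega)]; push_cast; linarith
  set cap : V → ℝ := fun v => D + (if v ∈ Bᶜ then (k : ℝ) else 0) with hcap
  have hdeg : ∀ v, (H.degree v : ℝ) ≤ cap v := by
    intro v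
    by_cases hv : v ∈ B
    · have : (H.degree v : ℝ) ≤ ((Fintype.card V - 1 - k : ℕ) : ℝ) := by exact_mod_cast hBdeg v hv
      rw [hDn] at this
      simpa [hcap, hv] using this
    · have : ((H.degree v + 1 : ℕ) : ℝ) ≤ Fintype.card V := by exact_mod_cast H.degree_lt_card_verts v
      push_cast at this
      simp only [hcap, Finset.mem_compl, hv, not_false_eq_true, if_true]
      linarith
  have hcapD : ∀ v, D ≤ cap v := fun v => by simp only [hcap]; split_ifs <;> linarith
  have h1 : (cap p - H.degree p) + (cap q - H.degree q) ≤ ∑ v ∈ Lᶜ, (cap v - H.degree v) := by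
    rw [← Finset.sum_pair (f := fun v => cap v - (H.degree v : ℝ)) hpq]
    refine Finset.sum_le_sum_of_subset_of_nonneg ?_ fun v _ _ => by linarith [hdeg v]
    intro v hv
    simp only [Finset.mem_insert, Finset.mem_singleton] at hv
    rcases hv with rfl | rfl <;> simpa
  have hBc : Bᶜ.card = k := by rw [Finset.card_compl]; omega
  have hLc : (Lᶜ.card : ℝ) = D + 1 := by
    have : Lᶜ.card + k = Fintype.card V := by rw [Finset.card_compl]; omega
    have : (Lᶜ.card : ℝ) + k = Fintype.card V := by exact_mod_cast this
    linarith
  have h2 : ∑ v ∈ Lᶜ, cap v = (D + 1) * D + k * k := by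
    simp only [hcap, Finset.sum_add_distrib, Finset.sum_ite_mem, Finset.sum_const, nsmul_eq_mul]
    rw [hLc, Finset.inter_eq_right.mpr (Finset.compl_subset_compl.mpr hLB), hBc]
  have h3 : ∑ v ∈ L, (H.degree v : ℝ) ≤ k * k := by
    have := Finset.sum_le_card_nsmul L (fun v => (H.degree v : ℝ)) k
      fun v hv => by exact_mod_cast hLdeg v hv
    rwa [hL, nsmul_eq_mul] at this
  have h4 := Finset.sum_add_sum_compl L fun v => (H.degree v : ℝ)
  rw [Finset.sum_sub_distrib, h2] at h1
  have := hcapD p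
  have := hcapD q
  nlinarith

/-- A vertex off X with a neighbour in X has degree at least n - k, because of the clique; if it
missed some vertex of X, of degree k, Ore's property would fail. An empty T would leave the vertices
of X with degree below k, and T lies in the neighbourhood of each of them. -/
theorem exists_isJoinDecomposition {V : Type*} [Fintype V] {H : SimpleGraph V}
    [DecidableRel H.Adj] {k : ℕ} (hk : 1 ≤ k) {X : Finset V} (hX : X.card = k)
    (hdeg : ∀ x ∈ X, H.degree x = k) (hkV : k + 1 ≤ Fintype.card V)
    (hclique : ∀ p q, p ∉ X → q ∉ X → p ≠ q → H.Adj p q)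
    (hore : ∀ u v, u ≠ v → ¬ H.Adj u v → H.degree u + H.degree v < Fintype.card V) :
    ∃ T : Finset V, IsJoinDecomposition H k X T ∧ 1 ≤ T.card ∧ T.card ≤ k := by
  classical
  set T := Finset.univ.filter fun v => v ∉ X ∧ ∀ x ∈ X, H.Adj v x with hT
  have hmem : ∀ v, v ∈ T ↔ v ∉ X ∧ ∀ x ∈ X, H.Adj v x := by simp [hT]
  have hna : ∀ c, c ∉ X → c ∉ T → ∀ x ∈ X, ¬ H.Adj c x := by
    intro c hc hcT x hx hcx
    have : ∃ x' ∈ X, ¬ H.Adj c x' := by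
      by_contra hcon
      push Not at hcon
      exact hcT ((hmem c).mpr ⟨hc, hcon⟩)
    obtain ⟨x', hx', hcx'⟩ := this
    have h1 := hore c x' (fun h => hc (h ▸ hx')) hcx'
    rw [hdeg x' hx'] at h1
    have h2 : insert x (Xᶜ.erase c) ⊆ H.neighborFinset c := by
      intro v hv
      rw [SimpleGraph.mem_neighborFinset]
      rcases Finset.mem_insert.mp hv with rfl | hv
      · exact hcx
      · rw [Finset.mem_erase, Finset.mem_compl] at hv
        exact hclique c v hc hv.2 hv.1.symm
    have h3 := Finset.card_le_card h2
    rw [Finset.card_insert_of_notMem (by simp [hx]), Finset.card_erase_of_mem (by simpa using hc),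
      Finset.card_compl, hX, SimpleGraph.card_neighborFinset_eq_degree] at h3
    omega
  refine ⟨T, ⟨hX, fun v hv => ((hmem v).mp hv).1, hclique, fun t ht => ((hmem t).mp ht).2, hna, hdeg⟩,
    ?_, ?_⟩
  · by_contra hcon
    have hT0 : T = ∅ := Finset.card_eq_zero.mp (by omega)
    obtain ⟨x, hx⟩ : X.Nonempty := Finset.card_pos.mp (by omega)
    have h2 : H.neighborFinset x ⊆ X.erase x := by
      intro v hv
      rw [SimpleGraph.mem_neighborFinset] at hv
      rw [Finset.mem_erase]
      refine ⟨hv.ne', ?_⟩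
      by_contra hvX
      exact hna v hvX (by simp [hT0]) x hx hv.symm
    have h3 := Finset.card_le_card h2
    rw [Finset.card_erase_of_mem hx, SimpleGraph.card_neighborFinset_eq_degree, hdeg x hx, hX] at h3
    omega
  · obtain ⟨x, hx⟩ : X.Nonempty := Finset.card_pos.mp (by omega)
    rw [← hdeg x hx, ← SimpleGraph.card_neighborFinset_eq_degree]
    refine Finset.card_le_card fun t ht => ?_
    rw [SimpleGraph.mem_neighborFinset]
    exact (((hmem t).mp ht).2 x hx).symm

/-! ### A spanning cycle when 2 ≤ |T| < k -/

/-- A cycle with two consecutive vertices in a clique absorbs further vertices of the clique. -/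
theorem hasSpanningCycle_of_chain_of_clique {V : Type*} [Fintype V] {H : SimpleGraph V}
    (Q : V → Prop) (hQ : ∀ p q, Q p → Q q → p ≠ q → H.Adj p q) (t s : V) (r : List V)
    (ht : Q t) (hs : Q s) (hnd : (t :: s :: r).Nodup)
    (hch : Cycle.Chain H.Adj ((t :: s :: r : List V) : Cycle V))
    (hmiss : ∀ c, c ∉ t :: s :: r → Q c) : HasSpanningCycle H := by
  classical
  induction hm : (Finset.univ \ (t :: s :: r).toFinset).card generalizing s r with
  | zero =>
    refine ⟨_, hnd, fun v => ?_, hch⟩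
    rw [Finset.card_eq_zero, Finset.sdiff_eq_empty_iff_subset] at hm
    exact List.mem_toFinset.mp (hm (Finset.mem_univ v))
  | succ m ih =>
    obtain ⟨c, hc⟩ : (Finset.univ \ (t :: s :: r).toFinset).Nonempty :=
      Finset.card_pos.mp (by omega)
    have hc' : c ∉ t :: s :: r := by
      rw [Finset.mem_sdiff, List.mem_toFinset] at hc
      exact hc.2
    have hct : t ≠ c := fun h => hc' (by simp [h])
    have hcs : c ≠ s := fun h => hc' (by simp [h])
    have hperm : (t :: c :: s :: r).Perm (c :: t :: s :: r) := List.Perm.swap _ _ _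
    -- The new vertex is inserted right after `t`, so the list again begins with two clique
    -- vertices.
    refine ih c (s :: r) (hmiss c hc') ?_ ?_ ?_ ?_
    · rw [hperm.nodup_iff]
      exact List.nodup_cons.mpr ⟨hc', hnd⟩
    · rw [Cycle.chain_coe_cons] at hch ⊢
      simp only [List.cons_append, List.isChain_cons_cons] at hch ⊢
      exact ⟨hQ _ _ ht (hmiss c hc') hct, hQ _ _ (hmiss c hc') hs hcs, hch.2⟩
    · intro d hd
      refine hmiss d fun h => hd ?_
      simp only [List.mem_cons] at h ⊢
      tauto
    · have : (t :: c :: s :: r).toFinset = insert c (t :: s :: r).toFinset := by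
        rw [List.toFinset_eq_of_perm _ _ hperm, List.toFinset_cons]
      rw [this, Finset.sdiff_insert, Finset.card_erase_of_mem hc, hm, Nat.add_sub_cancel]

/-- Set t₁ ∈ T aside. On X ∪ T \ {t₁}, of order k + |T| - 1 ≤ 2k - 2, vertices of X keep degree at
least k - 1 and those of T see everything, so Ore's theorem gives a cycle. Inserting t₁ next to
another t₂ ∈ T creates two consecutive clique vertices, between which the rest of the clique is
absorbed. -/
theorem IsJoinDecomposition.hasSpanningCycle {V : Type*} [Fintype V] {H : SimpleGraph V}
    [DecidableRel H.Adj] {k : ℕ} {X T : Finset V} (h : IsJoinDecomposition H k X T)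
    (h2 : 2 ≤ T.card) (hk : T.card < k) : HasSpanningCycle H := by
  classical
  obtain ⟨t₁, ht₁, t₂, ht₂, hne⟩ := Finset.one_lt_card.mp h2
  set W : Finset V := X ∪ T.erase t₁ with hW
  have hWc : W.card = k + (T.card - 1) := by
    rw [hW, Finset.card_union_of_disjoint, h.card_eq, Finset.card_erase_of_mem ht₁]
    rw [Finset.disjoint_left]
    exact fun x hx hx' => h.notMem x (Finset.mem_of_mem_erase hx') hx
  have hWmem : ∀ v, v ∈ W ↔ v ∈ X ∨ v ≠ t₁ ∧ v ∈ T := by simp [hW]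
  have hcard : Fintype.card (W : Set V) = k + (T.card - 1) := by
    rw [← hWc]; simp
  have hdeg : ∀ x : (W : Set V), (x : V) ∈ X → k - 1 ≤ (H.induce (W : Set V)).degree x := by
    intro x hx
    have hsub : (H.neighborFinset x).erase t₁ ⊆
        ((H.induce (W : Set V)).neighborFinset x).image Subtype.val := by
      intro v hv
      rw [Finset.mem_erase, SimpleGraph.mem_neighborFinset] at hv
      have hvW : v ∈ W := by
        rw [hWmem]
        by_contra hcon
        push Not at hcon
        exact h.not_adj v hcon.1 (hcon.2 hv.1) x hx hv.2.symm
      exact Finset.mem_image.mpr ⟨⟨v, hvW⟩, by simpa using hv.2, rfl⟩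
    have h1 := (Finset.card_le_card hsub).trans Finset.card_image_le
    have h2 := Finset.pred_card_le_card_erase (s := H.neighborFinset x) (a := t₁)
    rw [SimpleGraph.card_neighborFinset_eq_degree] at h1 h2
    rw [h.degree_eq x hx] at h2
    omega
  have hTadj : ∀ t ∈ T, ∀ v, t ≠ v → v ∈ X ∨ v ∈ T → H.Adj t v := by
    rintro t ht v hv (hvX | hvT)
    · exact h.adj t ht v hvX
    · exact h.clique t v (h.notMem t ht) (h.notMem v hvT) hv
  obtain ⟨l, hnd, hall, hch⟩ := hasSpanningCycle_of_ore (G := H.induce (W : Set V))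
    (by omega) (by
      intro u v huv hadj
      have hu := (hWmem u).mp u.2
      have hv := (hWmem v).mp v.2
      have huv' : (u : V) ≠ v := fun h => huv (Subtype.ext h)
      have huX : (u : V) ∈ X := by
        by_contra hcon
        exact hadj (hTadj u (by tauto) v huv' (by tauto))
      have hvX : (v : V) ∈ X := by
        by_contra hcon
        exact hadj (hTadj v (by tauto) u huv'.symm (by tauto)).symm
      have := hdeg u huX
      have := hdeg v hvX
      omega)
  have hll : (l.map Subtype.val).Nodup := hnd.map Subtype.val_injective
  have hmem : ∀ v, v ∈ l.map Subtype.val ↔ v ∈ W := by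
    intro v
    simp only [List.mem_map]
    constructor
    · rintro ⟨x, -, rfl⟩
      exact x.2
    · exact fun hv => ⟨⟨v, hv⟩, hall _, rfl⟩
  have hll' : Cycle.Chain H.Adj ((l.map Subtype.val : List V) : Cycle V) := by
    rw [← Cycle.map_coe, Cycle.chain_map]
    exact hch
  have ht₂W : t₂ ∈ W := (hWmem t₂).mpr (Or.inr ⟨hne.symm, ht₂⟩)
  obtain ⟨l₁, l₂, hl⟩ := List.append_of_mem ((hmem t₂).mpr ht₂W)
  have hrot : (l.map Subtype.val) ~r (t₂ :: (l₂ ++ l₁)) := by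
    rw [hl, ← List.cons_append]
    exact List.isRotated_append
  rw [Cycle.coe_eq_coe.mpr hrot] at hll'
  rw [hrot.nodup_iff] at hll
  have hmem' : ∀ v, v ∈ t₂ :: (l₂ ++ l₁) ↔ v ∈ W := fun v => by rw [← hrot.mem_iff, hmem]
  have hlen : (t₂ :: (l₂ ++ l₁)).length = W.card := by
    rw [← List.toFinset_card_of_nodup hll]
    congr 1
    ext v
    rw [List.mem_toFinset, hmem']
  cases hr : l₂ ++ l₁ with
  | nil => rw [hr] at hlen; simp at hlen; omega
  | cons a r =>
    rw [hr] at hll hll' hmem'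
    have ht₁W : t₁ ∉ W := fun hcon => by
      have := (hWmem t₁).mp hcon
      have := h.notMem t₁ ht₁
      tauto
    have haW := (hmem' a).mp (by simp)
    have hperm : (t₂ :: t₁ :: a :: r).Perm (t₁ :: t₂ :: a :: r) := List.Perm.swap _ _ _
    refine hasSpanningCycle_of_chain_of_clique (· ∉ X) h.clique t₂ t₁ (a :: r)
      (h.notMem _ ht₂) (h.notMem _ ht₁) ?_ ?_ ?_
    · rw [hperm.nodup_iff]
      exact List.nodup_cons.mpr ⟨fun hcon => ht₁W ((hmem' _).mp hcon), hll⟩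
    · rw [Cycle.chain_coe_cons] at hll' ⊢
      simp only [List.cons_append, List.isChain_cons_cons] at hll' ⊢
      refine ⟨hTadj _ ht₂ _ hne.symm (Or.inr ht₁), hTadj _ ht₁ _ (fun h => ht₁W (h ▸ haW)) ?_,
        hll'.2⟩
      have := (hWmem a).mp haW
      tauto
    · intro c hc hcX
      refine hc (hperm.mem_iff.mpr (List.mem_cons_of_mem _ ((hmem' c).mpr ?_)))
      exact (hWmem c).mpr (Or.inl hcX)

/-! ### Losing an edge lowers the spectral radius below D -/

/-- A spanning subgraph of minimum degree at least `k` of a join decomposed graph with large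
spectral radius is the whole graph. -/
theorem IsSubsolution.eq_of_le {V : Type*} [Fintype V] {G H : SimpleGraph V}
    [DecidableRel G.Adj] [DecidableRel H.Adj] {k : ℕ} {D : ℝ} {y : V → ℝ}
    (h : IsSubsolution G D y) (hGH : G ≤ H) {X T : Finset V} (hH : IsJoinDecomposition H k X T)
    (hT : T.card ≤ k) (hk : 1 ≤ k) (hδ : ∀ v, k ≤ G.degree v)
    (hV : (Fintype.card V : ℝ) = D + k + 1) (hD : (k : ℝ) ^ 3 / 2 + 3 ≤ D) : G = H := by
  classical
  refine le_antisymm hGH fun a b hab => ?_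
  by_contra hGab
  -- Vertices of X have degree exactly k in `H` and at least k in `G`, so a missing edge lies off X.
  have hX : ∀ a b, H.Adj a b → ¬ G.Adj a b → a ∉ X := by
    intro a b hab hGab haX
    have hsub : G.neighborFinset a ⊆ (H.neighborFinset a).erase b := by
      intro v hv
      rw [SimpleGraph.mem_neighborFinset] at hv
      rw [Finset.mem_erase, SimpleGraph.mem_neighborFinset]
      exact ⟨fun h => hGab (h ▸ hv), hGH hv⟩
    have h1 := Finset.card_le_card hsub
    rw [Finset.card_erase_of_mem (by simpa using hab), SimpleGraph.card_neighborFinset_eq_degree,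
      SimpleGraph.card_neighborFinset_eq_degree, hH.degree_eq a haX] at h1
    have := hδ a
    omega
  have haX := hX a b hab hGab
  have hbX := hX b a hab.symm fun h => hGab h.symm
  have hab' := hab.ne
  have hk' : (1 : ℝ) ≤ k := by exact_mod_cast hk
  have hkD : (k : ℝ) ^ 2 + k ≤ D := by
    nlinarith [mul_nonneg (by linarith : (0 : ℝ) ≤ k) (sq_nonneg ((k : ℝ) - 7 / 4)),
      sq_nonneg ((k : ℝ) - 7 / 4)]
  have hkD' : (k : ℝ) + 1 ≤ D := by nlinarith
  have hk2D : 2 * (k : ℝ) ^ 2 ≤ D + 8 := by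
    nlinarith [mul_nonneg (by linarith : (0 : ℝ) ≤ k) (sq_nonneg ((k : ℝ) - 5 / 2)),
      sq_nonneg ((k : ℝ) - 5 / 2)]
  set t : ℝ := (T.card : ℝ) with ht
  have htk : t ≤ k := by rw [ht]; exact_mod_cast hT
  have htk2 : 2 * (t * k ^ 2) < 4 * D - 10 := by
    have : t * (k : ℝ) ^ 2 ≤ k * k ^ 2 := by gcongr
    nlinarith
  set e : V → ℝ := fun v => if v = a ∨ v = b then 2 * D - 5 else 0 with he
  set w : V → ℝ := fun v => if v ∈ X then 2 * k * (D + 1) else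
    2 * (D ^ 2 - 1) - (if v ∈ T then 0 else 2 * (k : ℝ) ^ 2) - e v with hw
  -- Without the correction `e`, the row estimates for `H` off X exceed what is allowed by 2 |T| k²
  -- ≤ 2k³ ≤ 4D - 12. Lowering the weights of a and b by 2D - 5 each removes 4D - 10 from the row
  -- totals. In rows a and b the lowered right side is paid for by the absent neighbour, which needs
  -- 2k² ≤ D + 8.
  have hD5 : 0 ≤ 2 * D - 5 := by nlinarith [sq_nonneg ((k : ℝ))]
  have he0 : ∀ v, 0 ≤ e v := fun v => by simp only [he]; split_ifs <;> linarith
  have he1 : ∀ v, e v ≤ 2 * D - 5 := fun v => by simp only [he]; split_ifs <;> linarith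
  have hwlow : ∀ v, v ∉ X → 2 * (D ^ 2 - 1) - 2 * (k : ℝ) ^ 2 - (2 * D - 5) ≤ w v := fun v hv => by
    have := he1 v
    simp only [hw, hv, if_false]
    split_ifs <;> nlinarith [sq_nonneg (k : ℝ)]
  have hw0 : ∀ v, 0 ≤ w v := fun v => by
    by_cases hv : v ∈ X
    · simp only [hw, hv, if_true]; nlinarith
    · refine le_trans ?_ (hwlow v hv)
      nlinarith
  have hw1 : ∀ v, w v ≤ 2 * (D ^ 2 - 1) := fun v => by
    by_cases hv : v ∈ X
    · simp only [hw, hv, if_true]; nlinarith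
    · have := he0 v
      simp only [hw, hv, if_false]
      split_ifs <;> nlinarith [sq_nonneg (k : ℝ)]
  have hXc : (Xᶜ.card : ℝ) = D + 1 := by
    have : Xᶜ.card + k = Fintype.card V := by
      rw [Finset.card_compl, hH.card_eq, Nat.sub_add_cancel]
      rw [← hH.card_eq]
      exact Finset.card_le_univ X
    have : (Xᶜ.card : ℝ) + k = Fintype.card V := by exact_mod_cast this
    linarith
  have hTX : T ⊆ Xᶜ := fun v hv => Finset.mem_compl.mpr (hH.notMem v hv)
  have hsumC : ∑ v ∈ Xᶜ, w v = (D + 1) * (2 * (D ^ 2 - 1)) - (D + 1 - t) * (2 * k ^ 2)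
      - 2 * (2 * D - 5) := by
    have e1 : ∀ v ∈ Xᶜ, w v = (2 * (D ^ 2 - 1) - 2 * (k : ℝ) ^ 2) +
        (if v ∈ T then 2 * (k : ℝ) ^ 2 else 0) -
        ((if v ∈ ({a, b} : Finset V) then 2 * D - 5 else 0)) := by
      intro v hv
      rw [Finset.mem_compl] at hv
      simp only [hw, hv, if_false, he, Finset.mem_insert, Finset.mem_singleton]
      split_ifs <;> ring
    have hab2 : ({a, b} : Finset V) ⊆ Xᶜ := by
      intro v hv
      simp only [Finset.mem_insert, Finset.mem_singleton] at hv
      rcases hv with rfl | rfl <;> simpa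
    rw [Finset.sum_congr rfl e1, Finset.sum_sub_distrib, Finset.sum_add_distrib]
    simp only [Finset.sum_ite_mem, Finset.sum_const, nsmul_eq_mul]
    rw [Finset.inter_eq_right.mpr hTX, Finset.inter_eq_right.mpr hab2, hXc,
      Finset.card_pair hab', ← ht]
    push_cast
    ring
  have hsumV : ∑ v, w v = ∑ v ∈ Xᶜ, w v + k * (2 * k * (D + 1)) := by
    rw [← Finset.sum_add_sum_compl X w, add_comm]
    congr 1
    rw [Finset.sum_congr rfl fun v hv => show w v = 2 * k * (D + 1) by simp [hw, hv]]
    rw [Finset.sum_const, hH.card_eq, nsmul_eq_mul]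
  have hrow : ∀ u, u ∉ X → ∀ S : Finset V, Xᶜ ⊆ S → G.neighborFinset u ⊆ S →
      ∑ v ∈ G.neighborFinset u, w v + w u + (if u = a then w b else if u = b then w a else 0)
        ≤ ∑ v ∈ S, w v := by
    intro u hu S hS hN
    have huS : u ∈ S := hS (by simpa)
    have hunot : u ∉ G.neighborFinset u := by simp
    have key : ∀ c, c ∉ X → c ≠ u → ¬ G.Adj u c →
        ∑ v ∈ G.neighborFinset u, w v + w u + w c ≤ ∑ v ∈ S, w v := by
      intro c hc hcu hadj
      have : c ∉ insert u (G.neighborFinset u) := by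
        simp [hcu, hadj]
      have e1 : ∑ v ∈ G.neighborFinset u, w v + w u + w c
          = ∑ v ∈ insert c (insert u (G.neighborFinset u)), w v := by
        rw [Finset.sum_insert this, Finset.sum_insert hunot]; ring
      rw [e1]
      refine Finset.sum_le_sum_of_subset_of_nonneg ?_ fun v _ _ => hw0 v
      exact Finset.insert_subset (hS (by simpa)) (Finset.insert_subset huS hN)
    by_cases hua : u = a
    · subst hua
      rw [if_pos rfl]
      exact key b hbX hab'.symm hGab
    · by_cases hub : u = b
      · subst hub
        rw [if_neg hua, if_pos rfl]
        exact key a haX hab' fun h => hGab h.symm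
      · rw [if_neg hua, if_neg hub, add_zero, add_comm, ← Finset.sum_insert hunot]
        exact Finset.sum_le_sum_of_subset_of_nonneg (Finset.insert_subset huS hN)
          fun v _ _ => hw0 v
  have hedge : ∀ u, (D + 1) * e u ≤ if u = a then w b else if u = b then w a else 0 := by
    intro u
    have hlow : (D + 1) * (2 * D - 5) ≤ 2 * (D ^ 2 - 1) - 2 * (k : ℝ) ^ 2 - (2 * D - 5) := by
      nlinarith
    have ha := hwlow a haX
    have hb := hwlow b hbX
    by_cases hua : u = a
    · simp only [he, hua, true_or, if_true]; linarith
    · by_cases hub : u = b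
      · simp only [he, hub, or_true, if_true, hab'.symm, if_false]; linarith
      · simp only [he, hua, hub, or_self, if_false]; linarith
  refine h.false_of_supersolution w hw0 fun u => ?_
  have hedge := hedge u
  by_cases huX : u ∈ X
  · have hwu : w u = 2 * k * (D + 1) := by simp [hw, huX]
    have hd : ∑ v ∈ G.neighborFinset u, w v ≤ k * (2 * (D ^ 2 - 1)) := by
      have h1 := Finset.sum_le_card_nsmul (G.neighborFinset u) w _ fun v _ => hw1 v
      rw [SimpleGraph.card_neighborFinset_eq_degree, nsmul_eq_mul] at h1
      have h2 : (G.degree u : ℝ) ≤ k := by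
        rw [← hH.degree_eq u huX]
        exact_mod_cast SimpleGraph.degree_le_of_le hGH
      have h3 : 0 ≤ 2 * (D ^ 2 - 1) := by nlinarith
      exact h1.trans (by gcongr)
    rw [hwu]
    nlinarith
  · by_cases huT : u ∈ T
    · have hwu : w u = 2 * (D ^ 2 - 1) - e u := by simp [hw, huX, huT]
      have := hrow u huX Finset.univ (Finset.subset_univ _) (Finset.subset_univ _)
      rw [hsumV, hsumC] at this
      nlinarith
    · have hwu : w u = 2 * (D ^ 2 - 1) - 2 * k ^ 2 - e u := by simp [hw, huX, huT]
      have := hrow u huX Xᶜ (Finset.Subset.refl _) fun v hv => by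
        rw [Finset.mem_compl]
        rw [SimpleGraph.mem_neighborFinset] at hv
        exact fun hvX => hH.not_adj u huX huT v hvX (hGH hv)
      rw [hsumC] at this
      nlinarith

/-! ### Identification with the two exceptional graphs -/

theorem graphJoin_sum_adj {α β γ : Type*} (A : SimpleGraph α) (B : SimpleGraph β)
    (C : SimpleGraph γ) (x y : α ⊕ (β ⊕ γ)) :
    (graphJoin A (SimpleGraph.sum B C)).Adj x y ↔
      match x, y with
      | .inl a, .inl a' => A.Adj a a'
      | .inl _, .inr _ => True
      | .inr _, .inl _ => True
      | .inr (.inl b), .inr (.inl b') => B.Adj b b'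
      | .inr (.inr c), .inr (.inr c') => C.Adj c c'
      | .inr (.inl _), .inr (.inr _) => False
      | .inr (.inr _), .inr (.inl _) => False := by
  rcases x with a | b | c <;> rcases y with a' | b' | c' <;>
    simp [graphJoin, SimpleGraph.sum, completeBipartiteGraph]

/-- A join decomposition with `T` of order `p` and with `X` inducing `C` is
`K_p ∨ (K_{n-p-k} + C)`. -/
theorem IsJoinDecomposition.nonempty_iso {V : Type*} [Fintype V] {H : SimpleGraph V}
    [DecidableRel H.Adj] {k p q : ℕ} {X T : Finset V} (h : IsJoinDecomposition H k X T)
    (hT : T.card = p) (hq : p + (q + k) = Fintype.card V) (C : SimpleGraph (Fin k))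
    (hC : ∀ e : Fin k → V, Function.Injective e → (∀ i, e i ∈ X) →
      ∀ i j, H.Adj (e i) (e j) ↔ C.Adj i j) :
    Nonempty (H ≃g graphJoin (⊤ : SimpleGraph (Fin p))
      (SimpleGraph.sum (⊤ : SimpleGraph (Fin q)) C)) := by
  classical
  have hdisj : Disjoint X T := Finset.disjoint_right.mpr h.notMem
  set R : Finset V := (X ∪ T)ᶜ with hR
  have hRc : R.card = q := by
    rw [hR, Finset.card_compl, Finset.card_union_of_disjoint hdisj, h.card_eq, hT]
    omega
  have hRmem : ∀ v ∈ R, v ∉ X ∧ v ∉ T := by simp [hR]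
  set eT := (T.equivFinOfCardEq hT).symm
  set eR := (R.equivFinOfCardEq hRc).symm
  set eX := (X.equivFinOfCardEq h.card_eq).symm
  set f : Fin p ⊕ (Fin q ⊕ Fin k) → V :=
    Sum.elim (fun i => eT i) (Sum.elim (fun i => eR i) fun i => eX i) with hf
  have iT : ∀ i j, (eT i : V) = eT j ↔ i = j := fun i j =>
    ⟨fun h => eT.injective (Subtype.ext h), fun h => by rw [h]⟩
  have iR : ∀ i j, (eR i : V) = eR j ↔ i = j := fun i j =>
    ⟨fun h => eR.injective (Subtype.ext h), fun h => by rw [h]⟩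
  have iX : ∀ i j, (eX i : V) = eX j ↔ i = j := fun i j =>
    ⟨fun h => eX.injective (Subtype.ext h), fun h => by rw [h]⟩
  have nTX : ∀ i, (eT i : V) ∉ X := fun i => h.notMem _ (eT i).2
  have nRX : ∀ i, (eR i : V) ∉ X := fun i => (hRmem _ (eR i).2).1
  have nRT : ∀ i, (eR i : V) ∉ T := fun i => (hRmem _ (eR i).2).2
  have nTR : ∀ i j, (eT i : V) ≠ eR j := fun i j hij => nRT j (hij ▸ (eT i).2)
  have hinj : Function.Injective f := by
    rintro (a | b | c) (a' | b' | c') hab <;>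
      simp only [hf, Sum.elim_inl, Sum.elim_inr] at hab
    · rw [(iT _ _).mp hab]
    · exact absurd hab (nTR _ _)
    · exact absurd (hab ▸ (eX c').2) (nTX a)
    · exact absurd hab.symm (nTR _ _)
    · rw [(iR _ _).mp hab]
    · exact absurd (hab ▸ (eX c').2) (nRX b)
    · exact absurd (hab ▸ (eX c).2) (nTX a')
    · exact absurd (hab ▸ (eX c).2) (nRX b')
    · rw [(iX _ _).mp hab]
  have hbij : Function.Bijective f :=
    (Fintype.bijective_iff_injective_and_card f).mpr ⟨hinj, by simpa using hq⟩
  have hadj : ∀ u v, u ∉ X → v ∉ X → (H.Adj u v ↔ u ≠ v) := fun u v hu hv =>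
    ⟨fun h => h.ne, h.clique u v hu hv⟩
  refine ⟨(SimpleGraph.Iso.symm ⟨Equiv.ofBijective f hbij, ?_⟩)⟩
  intro x y
  rw [graphJoin_sum_adj]
  rcases x with a | b | c <;> rcases y with a' | b' | c' <;>
    simp only [Equiv.ofBijective_apply, hf, Sum.elim_inl, Sum.elim_inr, SimpleGraph.top_adj,
      iff_true, iff_false]
  · rw [hadj _ _ (nTX _) (nTX _), Ne, iT]
  · exact (hadj _ _ (nTX _) (nRX _)).mpr (nTR _ _)
  · exact h.adj _ (eT a).2 _ (eX c').2
  · exact (hadj _ _ (nRX _) (nTX _)).mpr (nTR _ _).symm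
  · rw [hadj _ _ (nRX _) (nRX _), Ne, iR]
  · exact h.not_adj _ (nRX _) (nRT _) _ (eX c').2
  · exact (h.adj _ (eT a').2 _ (eX c).2).symm
  · exact fun hh => h.not_adj _ (nRX _) (nRT _) _ (eX c).2 hh.symm
  · exact hC (fun i => eX i) (fun i j hij => (iX i j).mp hij) (fun i => (eX i).2) c c'

/-- A vertex x of X has k neighbours, all in T ∪ X \ {x}, which has only k elements; hence X is a
clique. -/
theorem IsJoinDecomposition.nonempty_iso_graphL {V : Type*} [Fintype V] {H : SimpleGraph V}
    [DecidableRel H.Adj] {k : ℕ} {X T : Finset V} (h : IsJoinDecomposition H k X T)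
    (hT : T.card = 1) (hV : k + 1 ≤ Fintype.card V) :
    Nonempty (H ≃g graphL k (Fintype.card V)) := by
  classical
  refine h.nonempty_iso hT (by omega) _ fun e he heX i j => ?_
  rw [SimpleGraph.top_adj]
  refine ⟨fun hh hij => hh.ne (by rw [hij]), fun hij => ?_⟩
  have hsub : (H.neighborFinset (e i)) ⊆ T ∪ X.erase (e i) := by
    intro v hv
    rw [SimpleGraph.mem_neighborFinset] at hv
    rw [Finset.mem_union, Finset.mem_erase]
    by_contra hcon
    push Not at hcon
    exact h.not_adj v (hcon.2 hv.ne') hcon.1 _ (heX i) hv.symm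
  have hX0 : 0 < X.card := Finset.card_pos.mpr ⟨_, heX i⟩
  have heq := Finset.eq_of_subset_of_card_le hsub (by
    refine (Finset.card_union_le _ _).trans ?_
    rw [Finset.card_erase_of_mem (heX i), SimpleGraph.card_neighborFinset_eq_degree,
      h.degree_eq _ (heX i), hT, h.card_eq]
    rw [h.card_eq] at hX0
    omega)
  rw [← SimpleGraph.mem_neighborFinset, heq, Finset.mem_union, Finset.mem_erase]
  exact Or.inr ⟨fun hh => hij (he hh).symm, heX j⟩

/-- T already accounts for all k neighbours of each vertex of X, so X is independent. -/
theorem IsJoinDecomposition.nonempty_iso_graphM {V : Type*} [Fintype V] {H : SimpleGraph V}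
    [DecidableRel H.Adj] {k : ℕ} {X T : Finset V} (h : IsJoinDecomposition H k X T)
    (hT : T.card = k) (hV : 2 * k ≤ Fintype.card V) :
    Nonempty (H ≃g graphM k (Fintype.card V)) := by
  classical
  refine h.nonempty_iso hT (by omega) _ fun e he heX i j => ?_
  rw [SimpleGraph.bot_adj, iff_false]
  intro hh
  have hsub : T ⊆ H.neighborFinset (e i) := fun t ht => by
    rw [SimpleGraph.mem_neighborFinset]
    exact (h.adj t ht _ (heX i)).symm
  have heq := Finset.eq_of_subset_of_card_le hsub (by
    rw [SimpleGraph.card_neighborFinset_eq_degree, h.degree_eq _ (heX i), hT])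
  rw [← SimpleGraph.mem_neighborFinset, ← heq] at hh
  exact h.notMem _ hh (heX j)

/-! ### The main theorem -/

theorem theorem3 (k n : ℕ) (hk : 1 ≤ k) (hn : (k : ℝ) ^ 3 / 2 + (k : ℝ) + 4 ≤ (n : ℝ))
    {V : Type*} [Fintype V] [DecidableEq V] (G : SimpleGraph V) [DecidableRel G.Adj]
    (hV : Fintype.card V = n) (hδ : k ≤ G.minDegree)
    (hspec : (n : ℝ) - (k : ℝ) - 1 ≤ graphSpectralRadius G) :
    (∃ (v : V) (c : G.Walk v v), c.IsHamiltonianCycle) ∨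
      Nonempty (G ≃g graphL k n) ∨ Nonempty (G ≃g graphM k n) := by
  classical
  subst hV
  have hk' : (1 : ℝ) ≤ k := by exact_mod_cast hk
  obtain ⟨d, hd⟩ : ∃ d : ℕ, Fintype.card V = d + k + 1 := by
    have : ((k + 1 : ℕ) : ℝ) ≤ Fintype.card V := by
      push_cast; nlinarith [pow_pos (by linarith : (0 : ℝ) < k) 3]
    have : k + 1 ≤ Fintype.card V := by exact_mod_cast this
    exact ⟨Fintype.card V - (k + 1), by omega⟩
  have hVD : (Fintype.card V : ℝ) = d + k + 1 := by rw [hd]; push_cast; ring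
  have hD : (k : ℝ) ^ 3 / 2 + 3 ≤ d := by linarith
  have hkD : (k : ℝ) ^ 2 + k < d := by
    nlinarith [mul_nonneg (by linarith : (0 : ℝ) ≤ k) (sq_nonneg ((k : ℝ) - 7 / 4)),
      sq_nonneg ((k : ℝ) - 7 / 4)]
  -- Integrality enters here: d > 3 gives d ≥ 4, which the case k = 1 of `chvatal_index_inequality`
  -- asks for.
  have hd4 : 4 ≤ d := by
    have : (3 : ℝ) < d := by nlinarith [pow_pos (by linarith : (0 : ℝ) < k) 3]
    have : 3 < d := by exact_mod_cast this
    omega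
  have hkd : k ≤ d := by
    have : (k : ℝ) ≤ d := by nlinarith
    exact_mod_cast this
  have h3 : 3 ≤ Fintype.card V := by omega
  by_cases hG : HasSpanningCycle G
  · exact Or.inl (hG.exists_isHamiltonianCycle h3)
  refine Or.inr ?_
  obtain ⟨y, hy⟩ := exists_isSubsolution_of_le_graphSpectralRadius G (D := d)
    (by have : 0 < d := by omega
        exact_mod_cast this) (by linarith)
  have hGdeg : ∀ v, k ≤ G.degree v := fun v => hδ.trans (G.minDegree_le_degree v)
  obtain ⟨H, hGH, hH, hore⟩ := exists_le_ore_of_not_hasSpanningCycle h3 hG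
  have hore := @hore (Classical.decRel _)
  have hHdeg : ∀ v, k ≤ H.degree v := fun v =>
    (hGdeg v).trans (SimpleGraph.degree_le_of_le hGH)
  have hyH := hy.mono hGH
  obtain ⟨i, X, B, hki, hi, hXB, hXc, hBc, hXdeg, hBdeg⟩ := exists_chvatal_index h3 hH hore hHdeg
  obtain rfl : k = i := by
    by_contra hne
    have hlt : k < i := lt_of_le_of_ne hki hne
    obtain ⟨j, rfl⟩ := Nat.exists_eq_add_of_le hki
    have hj : 1 ≤ j := by omega
    refine hyH.chvatal_index_le hVD hi hlt hXB hXc hBc hXdeg hBdeg ?_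
    have hineq := chvatal_index_inequality (k := k) (j := j) (D := d)
      (by
        rcases (by omega : k = 1 ∨ k = 2 ∨ 3 ≤ k) with h | h | h
        · exact Or.inl (by exact_mod_cast h)
        · exact Or.inr (Or.inl (by exact_mod_cast h))
        · exact Or.inr (Or.inr (by exact_mod_cast h)))
      (by exact_mod_cast hj) hD
      (by
        have : k + 2 * j ≤ d := by omega
        exact_mod_cast this)
      (fun _ => by exact_mod_cast hd4)
      (fun hk2 hd8 => by
        have h1 : k = 2 := by exact_mod_cast hk2
        have h2 : d < 8 := by exact_mod_cast hd8
        have : j ≤ 2 := by omega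
        exact_mod_cast this)
    push_cast
    convert hineq using 2 <;> ring
  have hclique : ∀ p q, p ∉ X → q ∉ X → p ≠ q → H.Adj p q := fun p q =>
    isClique_compl_of_sum_degree hVD hkD (hyH.mul_le_sum_degree (Nat.cast_nonneg d) hHdeg) hore
      hXB hXc hBc hXdeg hBdeg
  obtain ⟨T, hdec, hT1, hTk⟩ := exists_isJoinDecomposition hk hXc
    (fun x hx => le_antisymm (hXdeg x hx) (hHdeg x)) (by omega) hclique hore
  obtain rfl : G = H := hy.eq_of_le hGH hdec hTk hk hGdeg hVD hD
  -- Only the decidability instance changes, from the classical one for `H` to the given one for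
  -- `G`.
  have hdec : IsJoinDecomposition G k X T := by convert hdec
  have hT : T.card = 1 ∨ T.card = k := by
    by_contra hcon
    push Not at hcon
    exact hG (hdec.hasSpanningCycle (by omega) (by omega))
  rcases hT with hT | hT
  · exact Or.inl (hdec.nonempty_iso_graphL hT (by omega))
  · exact Or.inr (hdec.nonempty_iso_graphM hT (by omega))
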